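/- Let $\mathrm{Diff}_+^{1+lip}(\mathrm{S}^1)$ denote the group of orientation-preserving $C^1$ diffeomorphisms of the circle $\mathrm{S}^1=\mathbb{R}/\mathbb{Z}$ whose derivative is Lipschitz, and let $\Gamma$ be a subgroup of $\mathrm{Diff}_+^{1+lip}(\mathrm{S}^1)$. If $\Gamma$ preserves no Borel probability measure on $\mathrm{S}^1$, then there exists an element $f\in\Gamma$ having at least two hyperbolic fixed points, one contracting and one expanding; that is, there are distinct points $p,q\in\mathrm{S}^1$ with $f(p)=p$, $f(q)=q$ and $0<f'(p)<1<f'(q)$. -/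

import Mathlib

open MeasureTheory

/-- The circle is `UnitAddCircle = ℝ / ℤ`.  `IsCircleLift F f` says that `F : ℝ → ℝ` is a
continuous lift of `f : ℝ / ℤ → ℝ / ℤ` to the universal cover. -/
def IsCircleLift (F : ℝ → ℝ) (f : UnitAddCircle → UnitAddCircle) : Prop :=
  Continuous F ∧ ∀ x : ℝ, (F x : UnitAddCircle) = f (x : UnitAddCircle)

/-- The circle map `f` has derivative `d` at the point `p`: some continuous lift of `f` has
derivative `d` at some real number above `p`.  (Two lifts of `f` differ by a constant integer,
and `F (x + 1) - F x` is a constant integer, so the choices do not matter.) -/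
def HasCircleDerivAt (f : UnitAddCircle → UnitAddCircle) (d : ℝ) (p : UnitAddCircle) : Prop :=
  ∃ F : ℝ → ℝ, IsCircleLift F f ∧ ∃ x : ℝ, (x : UnitAddCircle) = p ∧ HasDerivAt F d x

/-- `f` belongs to `Diff₊^{1+lip}(S¹)`: it is an orientation-preserving `C¹` diffeomorphism of the
circle whose derivative is Lipschitz.  In terms of a lift `F` of the homeomorphism `f`: `F` is
`C¹`, `F' > 0` everywhere, and `F'` is Lipschitz.  (The inverse of `f` is then of the same
kind.) -/
def IsDiffOneLip (f : UnitAddCircle ≃ₜ UnitAddCircle) : Prop :=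
  ∃ F : ℝ → ℝ, IsCircleLift F f ∧ ContDiff ℝ 1 F ∧ (∀ x, 0 < deriv F x) ∧
    ∃ K : NNReal, LipschitzWith K (deriv F)

/-- `p` is a hyperbolic contracting fixed point of the orientation-preserving circle map `f`:
`f p = p` and `0 < f'(p) < 1`. -/
def IsContractingFixedPt (f : UnitAddCircle → UnitAddCircle) (p : UnitAddCircle) : Prop :=
  Function.IsFixedPt f p ∧ ∃ d : ℝ, HasCircleDerivAt f d p ∧ 0 < d ∧ d < 1

/-- `p` is a hyperbolic expanding fixed point of the orientation-preserving circle map `f`: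
`f p = p` and `f'(p) > 1`. -/
def IsExpandingFixedPt (f : UnitAddCircle → UnitAddCircle) (p : UnitAddCircle) : Prop :=
  Function.IsFixedPt f p ∧ ∃ d : ℝ, HasCircleDerivAt f d p ∧ 1 < d

/-- The (Borel) measure `μ` on the circle is preserved by every element of `Γ`. -/
def IsInvariantUnder (Γ : Subgroup (UnitAddCircle ≃ₜ UnitAddCircle))
    (μ : Measure UnitAddCircle) : Prop :=
  ∀ f ∈ Γ, MeasurePreserving f μ μ

open Filter Topology Set Function

/-! ### Bounded distortion and contracting fixed points on the line -/

/-! Work with lifts to the line, and let `K` be the preimage of a minimal closed invariant set of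
the circle. Suppose every lift with a fixed point fixes `K` pointwise. Then an inequality between
two lifts at one point holds on all of `K`, which makes the translation number a homomorphism. The
action is then semiconjugate to translations by a monotone map, and the image of Lebesgue measure is
invariant (`exists_invariant_measure`).

So, without an invariant measure, some `G` has fixed points and moves a point `k` of `K` to the
right. Let `(a, b)` be the component of the complement of its fixed point set containing `k`; then
`b = lim G^n k` lies in `K`. Minimality gives `F` with `F a < a < F b < b` (`exists_crossing`).

For large `n`, `F ∘ G^n` maps a fundamental domain of `G` around `F b` into its own interior. The
images of that domain under iterates of `G` have disjoint interiors, so the Lipschitz bound on `G'`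
controls distortion and the fixed point found there is contracting. Since `F⁻¹ a` lies in `(a, b)`,
the same argument for `F⁻¹ ∘ G⁻ⁿ` yields an expanding fixed point of `F ∘ G^n`, with the same `n`.
-/

theorem hasDerivAt_iterate_prod {G : ℝ → ℝ} (hG : Differentiable ℝ G) (n : ℕ) (x : ℝ) :
    HasDerivAt G^[n] (∏ i ∈ Finset.range n, deriv G (G^[i] x)) x := by
  induction n with
  | zero => simpa using hasDerivAt_id x
  | succ n ih =>
    rw [Finset.prod_range_succ, mul_comm, iterate_succ']
    exact (hG _).hasDerivAt.comp x ih

/-- Bounded distortion: at each time the two derivatives differ by at most `K` times the length of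
the interval, which is a relative error of at most `K / m` times that length; `1 + t ≤ exp t` turns
the product of these errors into the exponential of a sum. -/
theorem prod_deriv_iterate_le {G : ℝ → ℝ} (hmono : Monotone G) {K : NNReal}
    (hK : LipschitzWith K (deriv G)) {m : ℝ} (hm : 0 < m) (hmG : ∀ x, m ≤ deriv G x)
    {u v a b : ℝ} (ha : a ∈ Icc u v) (hb : b ∈ Icc u v) (n : ℕ) :
    ∏ i ∈ Finset.range n, deriv G (G^[i] a) ≤
      Real.exp (K / m * ∑ i ∈ Finset.range n, (G^[i] v - G^[i] u)) *
        ∏ i ∈ Finset.range n, deriv G (G^[i] b) := by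
  have hpos : ∀ x, 0 < deriv G x := fun x => hm.trans_le (hmG x)
  rw [Finset.mul_sum, Real.exp_sum, ← Finset.prod_mul_distrib]
  refine Finset.prod_le_prod (fun i _ => (hpos _).le) fun i _ => ?_
  have hab : |G^[i] a - G^[i] b| ≤ G^[i] v - G^[i] u := by
    have h := hmono.iterate i
    have := h ha.1; have := h ha.2; have := h hb.1; have := h hb.2
    rw [abs_le]; constructor <;> linarith
  have h1 : deriv G (G^[i] a) - deriv G (G^[i] b) ≤ K * (G^[i] v - G^[i] u) := by
    have := hK.dist_le_mul (G^[i] a) (G^[i] b)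
    rw [Real.dist_eq, Real.dist_eq] at this
    exact (le_abs_self _).trans (this.trans (by gcongr))
  have h2 : K * (G^[i] v - G^[i] u) ≤
      K / m * (G^[i] v - G^[i] u) * deriv G (G^[i] b) := by
    have : 0 ≤ K / m * (G^[i] v - G^[i] u) :=
      mul_nonneg (by positivity) ((abs_nonneg _).trans hab)
    calc K * (G^[i] v - G^[i] u) = K / m * (G^[i] v - G^[i] u) * m := by field_simp
      _ ≤ _ := by gcongr; exact hmG _
  have h3 := mul_le_mul_of_nonneg_right
    (Real.add_one_le_exp (K / m * (G^[i] v - G^[i] u))) (hpos (G^[i] b)).le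
  linarith

/-- If the iterates of `[u, v]` under `G` have bounded total length and shrink to `β`, and `F`
maps `β` into `(u, v)`, then `F ∘ G^[n]` has a contracting fixed point in `(u, v)` for large `n`. -/
theorem eventually_exists_contracting_fixedPt {F G : ℝ → ℝ} (hF : ContDiff ℝ 1 F)
    (hF0 : ∀ x, 0 < deriv F x) (hG : Differentiable ℝ G) {K : NNReal}
    (hK : LipschitzWith K (deriv G)) {m : ℝ} (hm : 0 < m) (hmG : ∀ x, m ≤ deriv G x)
    {u v β C : ℝ} (huv : u < v)
    (hsum : ∀ n, ∑ i ∈ Finset.range n, (G^[i] v - G^[i] u) ≤ C)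
    (hu : Tendsto (fun n => G^[n] u) atTop (𝓝 β)) (hv : Tendsto (fun n => G^[n] v) atTop (𝓝 β))
    (hβ : F β ∈ Ioo u v) :
    ∀ᶠ n in atTop, ∃ x, F (G^[n] x) = x ∧
      ∃ d, HasDerivAt (fun y => F (G^[n] y)) d x ∧ 0 < d ∧ d < 1 := by
  have hpos : ∀ x, 0 < deriv G x := fun x => hm.trans_le (hmG x)
  have hmono : StrictMono G := strictMono_of_deriv_pos hpos
  have hFc : Continuous F := hF.continuous
  have hFd : Differentiable ℝ F := hF.differentiable (by norm_num)
  have hF'c : Continuous (deriv F) := hF.continuous_deriv le_rfl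
  obtain ⟨M, hM⟩ : ∃ M, deriv F β < M := exists_gt _
  have hM0 : 0 < M := (hF0 β).trans hM
  obtain ⟨ε, hε, hεM⟩ := Metric.eventually_nhds_iff.1
    ((hF'c.tendsto β).eventually (gt_mem_nhds hM))
  have e1 := hu.eventually (Metric.ball_mem_nhds β hε)
  have e2 := hv.eventually (Metric.ball_mem_nhds β hε)
  have e3 := ((hFc.tendsto β).comp hu).eventually (lt_mem_nhds hβ.1)
  have e4 := ((hFc.tendsto β).comp hv).eventually (gt_mem_nhds hβ.2)
  have e5 : ∀ᶠ n in atTop,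
      M * (Real.exp (K / m * C) * ((G^[n] v - G^[n] u) / (v - u))) < 1 := by
    have : Tendsto (fun n => M * (Real.exp (K / m * C) * ((G^[n] v - G^[n] u) / (v - u)))) atTop
        (𝓝 (M * (Real.exp (K / m * C) * ((β - β) / (v - u))))) :=
      (((hv.sub hu).div_const _).const_mul _).const_mul _
    exact this.eventually (gt_mem_nhds (by simp))
  filter_upwards [e1, e2, e3, e4, e5] with n h1 h2 h3 h4 h5
  have hGn : ∀ x, HasDerivAt G^[n] (∏ i ∈ Finset.range n, deriv G (G^[i] x)) x :=
    hasDerivAt_iterate_prod hG n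
  have hcont : ContinuousOn (fun y => F (G^[n] y) - y) (Icc u v) :=
    ((hFc.comp (hG.continuous.iterate n)).sub continuous_id).continuousOn
  -- For this `n` the map sends both ends of `[u, v]` inside `(u, v)`.
  obtain ⟨x, hx, hx0⟩ := intermediate_value_Icc' huv.le hcont
    (show (0 : ℝ) ∈ Icc _ _ from ⟨by simp only [comp] at h4; linarith,
      by simp only [comp] at h3; linarith⟩)
  refine ⟨x, by linarith, _, (hFd _).hasDerivAt.comp x (hGn x), ?_, ?_⟩
  · exact mul_pos (hF0 _) (Finset.prod_pos fun i _ => hpos _)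
  · have hxε : deriv F (G^[n] x) < M := by
      apply hεM
      have ha := (hmono.monotone.iterate n) hx.1
      have hb := (hmono.monotone.iterate n) hx.2
      rw [Real.dist_eq, abs_lt] at h1 h2
      rw [Real.dist_eq, abs_lt]
      constructor <;> linarith [h1.1, h2.2]
    -- At some `c` the derivative of `G^[n]` is the mean slope, which tends to zero; distortion
    -- transfers this bound to the fixed point `x`.
    obtain ⟨c, hc, hc'⟩ := exists_hasDerivAt_eq_slope G^[n] _ huv
      (hG.continuous.iterate n).continuousOn (fun y _ => hGn y)
    have hd := prod_deriv_iterate_le hmono.monotone hK hm hmG hx (Ioo_subset_Icc_self hc) n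
    rw [hc'] at hd
    have hslope : 0 ≤ (G^[n] v - G^[n] u) / (v - u) :=
      div_nonneg (sub_nonneg.2 ((hmono.monotone.iterate n) huv.le)) (sub_nonneg.2 huv.le)
    calc _ ≤ M * (Real.exp (K / m * C) * ((G^[n] v - G^[n] u) / (v - u))) := by
          apply mul_le_mul hxε.le (hd.trans ?_) (Finset.prod_nonneg fun i _ => (hpos _).le) hM0.le
          gcongr
          exact hsum n
      _ < 1 := h5

theorem tendsto_iterate_right {G : ℝ → ℝ} (hc : Continuous G) (hmono : StrictMono G) {a b : ℝ}
    (hb : G b = b) (hlt : ∀ x ∈ Ioo a b, x < G x) {x : ℝ} (hx : x ∈ Ioo a b) :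
    Tendsto (fun n => G^[n] x) atTop (𝓝 b) := by
  have hle : ∀ n, G^[n] x ≤ b := fun n =>
    (hmono.monotone.iterate n hx.2.le).trans_eq (iterate_fixed hb n)
  have hm : Monotone fun n => G^[n] x :=
    hmono.monotone.monotone_iterate_of_le_map (hlt x hx).le
  have ht := tendsto_atTop_ciSup hm ⟨b, by rintro _ ⟨n, rfl⟩; exact hle n⟩
  have hfix := isFixedPt_of_tendsto_iterate ht hc.continuousAt
  have h1 : ⨆ n, G^[n] x ≤ b := ciSup_le hle
  have h2 : x ≤ ⨆ n, G^[n] x := le_ciSup (f := fun n => G^[n] x)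
    ⟨b, by rintro _ ⟨n, rfl⟩; exact hle n⟩ 0
  rcases h1.lt_or_eq with h | h
  · exact absurd hfix.eq (hlt _ ⟨hx.1.trans_le h2, h⟩).ne'
  · rwa [h] at ht

theorem tendsto_iterate_left {G : ℝ → ℝ} (hc : Continuous G) (hmono : StrictMono G) {a b : ℝ}
    (ha : G a = a) (hlt : ∀ x ∈ Ioo a b, G x < x) {x : ℝ} (hx : x ∈ Ioo a b) :
    Tendsto (fun n => G^[n] x) atTop (𝓝 a) := by
  have hge : ∀ n, a ≤ G^[n] x := fun n =>
    (iterate_fixed ha n).symm.trans_le (hmono.monotone.iterate n hx.1.le)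
  have hm : Antitone fun n => G^[n] x :=
    hmono.monotone.antitone_iterate_of_map_le (hlt x hx).le
  have hbdd : BddBelow (range fun n => G^[n] x) := ⟨a, by rintro _ ⟨n, rfl⟩; exact hge n⟩
  have ht := tendsto_atTop_ciInf hm hbdd
  have hfix := isFixedPt_of_tendsto_iterate ht hc.continuousAt
  have h1 : a ≤ ⨅ n, G^[n] x := le_ciInf hge
  have h2 : ⨅ n, G^[n] x ≤ x := ciInf_le hbdd 0
  rcases h1.lt_or_eq with h | h
  · exact absurd hfix.eq (hlt _ ⟨h, h2.trans_lt hx.2⟩).ne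
  · rwa [← h] at ht

/-- If `b` attracts `(a, b)` under `G` and `F` maps `b` into `(a, b)`, then `F ∘ G^[n]` has a
contracting fixed point for large `n`. -/
theorem eventually_contracting_of_attracting_right {F G : ℝ → ℝ} (hF : ContDiff ℝ 1 F)
    (hF0 : ∀ x, 0 < deriv F x) (hG : Differentiable ℝ G) {K : NNReal}
    (hK : LipschitzWith K (deriv G)) {m : ℝ} (hm : 0 < m) (hmG : ∀ x, m ≤ deriv G x)
    {a b : ℝ} (hb : G b = b) (hlt : ∀ x ∈ Ioo a b, x < G x) (hFb : F b ∈ Ioo a b) :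
    ∀ᶠ n in atTop, ∃ x, F (G^[n] x) = x ∧
      ∃ d, HasDerivAt (fun y => F (G^[n] y)) d x ∧ 0 < d ∧ d < 1 := by
  have hmono : StrictMono G := strictMono_of_deriv_pos fun x => hm.trans_le (hmG x)
  have hc := hG.continuous
  -- Choosing `u` just left of `F b` puts `F b` inside the fundamental domain `[u, G u]`, whose
  -- iterates abut, so that their lengths telescope.
  obtain ⟨u, ⟨hu1, hu2⟩, hu3⟩ : ∃ u, u ∈ Ioo a (F b) ∧ F b < G u := by
    have e1 : ∀ᶠ u in 𝓝[<] (F b), u ∈ Ioo a (F b) := Ioo_mem_nhdsLT hFb.1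
    have e2 : ∀ᶠ u in 𝓝[<] (F b), F b < G u :=
      ((hc.tendsto (F b)).mono_left inf_le_left).eventually (lt_mem_nhds (hlt _ hFb))
    exact (e1.and e2).exists
  have hu : u ∈ Ioo a b := ⟨hu1, hu2.trans hFb.2⟩
  have ht := tendsto_iterate_right hc hmono hb hlt hu
  refine eventually_exists_contracting_fixedPt (v := G u) (C := b - u) hF hF0 hG hK hm hmG
    (hu2.trans hu3) (fun n => ?_) ht ?_ ⟨hu2, hu3⟩
  · simp only [← iterate_succ_apply]
    rw [Finset.sum_range_sub (fun i => G^[i] u)]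
    have := (hmono.monotone.iterate n hu.2.le).trans_eq (iterate_fixed hb n)
    simpa using this
  · simpa only [← iterate_succ_apply] using (tendsto_add_atTop_iff_nat 1).2 ht

/-- If `a` attracts `(a, b)` under `G` and `F` maps `a` into `(a, b)`, then `F ∘ G^[n]` has a
contracting fixed point for large `n`. -/
theorem eventually_contracting_of_attracting_left {F G : ℝ → ℝ} (hF : ContDiff ℝ 1 F)
    (hF0 : ∀ x, 0 < deriv F x) (hG : Differentiable ℝ G) {K : NNReal}
    (hK : LipschitzWith K (deriv G)) {m : ℝ} (hm : 0 < m) (hmG : ∀ x, m ≤ deriv G x)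
    {a b : ℝ} (ha : G a = a) (hlt : ∀ x ∈ Ioo a b, G x < x) (hFa : F a ∈ Ioo a b) :
    ∀ᶠ n in atTop, ∃ x, F (G^[n] x) = x ∧
      ∃ d, HasDerivAt (fun y => F (G^[n] y)) d x ∧ 0 < d ∧ d < 1 := by
  have hmono : StrictMono G := strictMono_of_deriv_pos fun x => hm.trans_le (hmG x)
  have hc := hG.continuous
  obtain ⟨v, ⟨hv1, hv2⟩, hv3⟩ : ∃ v, v ∈ Ioo (F a) b ∧ G v < F a := by
    have e1 : ∀ᶠ v in 𝓝[>] (F a), v ∈ Ioo (F a) b := Ioo_mem_nhdsGT hFa.2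
    have e2 : ∀ᶠ v in 𝓝[>] (F a), G v < F a :=
      ((hc.tendsto (F a)).mono_left inf_le_left).eventually (gt_mem_nhds (hlt _ hFa))
    exact (e1.and e2).exists
  have hv : v ∈ Ioo a b := ⟨hFa.1.trans hv1, hv2⟩
  have ht := tendsto_iterate_left hc hmono ha hlt hv
  refine eventually_exists_contracting_fixedPt (u := G v) (C := v - a) hF hF0 hG hK hm hmG
    (hv3.trans hv1) (fun n => ?_) ?_ ht ⟨hv3, hv1⟩
  · simp only [← iterate_succ_apply]
    rw [Finset.sum_range_sub' (fun i => G^[i] v)]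
    exact sub_le_sub_left ((iterate_fixed ha n).symm.trans_le (hmono.monotone.iterate n hv.1.le)) v
  · simpa only [← iterate_succ_apply] using (tendsto_add_atTop_iff_nat 1).2 ht

/-! ### The group of lifts -/

theorem UnitAddCircle.coe_eq_coe_iff {x y : ℝ} :
    (x : UnitAddCircle) = y ↔ ∃ m : ℤ, x = y + m := by
  rw [eq_comm, QuotientAddGroup.eq, AddSubgroup.mem_zmultiples_iff]
  constructor
  · rintro ⟨m, hm⟩; exact ⟨m, by simp at hm; linarith⟩
  · rintro ⟨m, hm⟩; exact ⟨m, by simp [hm]⟩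

/-- The group of all lifts to `ℝ` of elements of `Γ` that commute with the unit translation. -/
def liftGroup (Γ : Subgroup (UnitAddCircle ≃ₜ UnitAddCircle)) : Subgroup CircleDeg1Liftˣ where
  carrier := {F | ∃ f ∈ Γ, ∀ x : ℝ, (F x : UnitAddCircle) = f x}
  one_mem' := ⟨1, Γ.one_mem, fun x => rfl⟩
  mul_mem' := by
    rintro F G ⟨f, hf, hF⟩ ⟨g, hg, hG⟩
    refine ⟨f * g, Γ.mul_mem hf hg, fun x => ?_⟩
    rw [Units.val_mul, CircleDeg1Lift.mul_apply, hF, hG]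
    rfl
  inv_mem' := by
    rintro F ⟨f, hf, hF⟩
    refine ⟨f⁻¹, Γ.inv_mem hf, fun x => ?_⟩
    apply f.injective
    rw [← hF, CircleDeg1Lift.units_apply_inv_apply]
    exact (f.apply_symm_apply _).symm

namespace CircleDeg1Lift

theorem units_strictMono (F : CircleDeg1Liftˣ) : StrictMono F := (toOrderIso F).strictMono

theorem units_continuous (F : CircleDeg1Liftˣ) : Continuous F := (toOrderIso F).continuous

theorem units_mul_apply (F G : CircleDeg1Liftˣ) (x : ℝ) :
    (F * G : CircleDeg1Liftˣ) x = F (G x) := rfl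

theorem units_coe_pow (F : CircleDeg1Liftˣ) (n : ℕ) : ⇑((F ^ n : CircleDeg1Liftˣ)) = F^[n] := by
  rw [Units.val_pow_eq_pow_val, coe_pow]

end CircleDeg1Lift

open CircleDeg1Lift

theorem translate_int_mem_liftGroup (Γ : Subgroup (UnitAddCircle ≃ₜ UnitAddCircle)) (m : ℤ) :
    translate (Multiplicative.ofAdd (m : ℝ)) ∈ liftGroup Γ :=
  ⟨1, Γ.one_mem, fun x => by
    rw [translate_apply]
    exact UnitAddCircle.coe_eq_coe_iff.2 ⟨m, add_comm _ _⟩⟩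

theorem sub_eq_of_continuous_of_coe_eq {F G : ℝ → ℝ} (hF : Continuous F) (hG : Continuous G)
    (h : ∀ x, (F x : UnitAddCircle) = G x) : ∃ m : ℤ, ∀ x, F x = G x + m := by
  choose m hm using fun x => UnitAddCircle.coe_eq_coe_iff.1 (h x)
  have hc : Continuous fun x => ((m x : ℤ) : ℝ) := by
    have : (fun x => ((m x : ℤ) : ℝ)) = fun x => F x - G x := by ext x; rw [hm x]; ring
    rw [this]; exact hF.sub hG
  have hc' : Continuous m := Int.isClosedEmbedding_coe_real.isInducing.continuous_iff.2 hc
  refine ⟨m 0, fun x => ?_⟩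
  rw [hm x, PreconnectedSpace.constant inferInstance hc' (x := x) (y := 0)]

/-- A lift of a circle homeomorphism with positive derivative is a degree one lift. -/
theorem IsCircleLift.exists_units {f : UnitAddCircle ≃ₜ UnitAddCircle} {F : ℝ → ℝ}
    (hF : IsCircleLift F f) (hmono : StrictMono F) : ∃ G : CircleDeg1Liftˣ, ⇑G = F := by
  obtain ⟨m, hm⟩ := sub_eq_of_continuous_of_coe_eq (F := fun x => F (x + 1)) (G := F)
    (hF.1.comp (continuous_id.add continuous_const)) hF.1 fun x => by
      rw [hF.2, hF.2]; congr 1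
      exact UnitAddCircle.coe_eq_coe_iff.2 ⟨1, by simp⟩
  have hm0 : 0 < m := by
    have := hmono (show (0 : ℝ) < 0 + 1 by norm_num)
    rw [hm] at this
    exact_mod_cast (lt_add_iff_pos_right _).1 this
  have hm1 : m = 1 := by
    -- With degree at least 2, `F` would take the value `F 0 + 1` strictly between `0` and `1`,
    -- against injectivity of `f`.
    by_contra hne
    have hm2 : (2 : ℝ) ≤ m := by exact_mod_cast (show (2 : ℤ) ≤ m by omega)
    obtain ⟨x, hx, hx1⟩ := intermediate_value_Ioo (show (0 : ℝ) ≤ 0 + 1 by norm_num)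
      hF.1.continuousOn (show F 0 + 1 ∈ Ioo (F 0) (F (0 + 1)) by
        rw [hm]; constructor <;> linarith)
    have : (x : UnitAddCircle) = (0 : ℝ) := by
      apply f.injective
      rw [← hF.2, ← hF.2]
      exact UnitAddCircle.coe_eq_coe_iff.2 ⟨1, by simp [hx1]⟩
    obtain ⟨k, hk⟩ := UnitAddCircle.coe_eq_coe_iff.1 this
    have h1 := hx.1
    have h2 := hx.2
    rw [hk] at h1 h2
    norm_num at h1 h2
    have h2 : k < 1 := by exact_mod_cast h2
    omega
  subst hm1
  let G : CircleDeg1Lift := ⟨⟨F, hmono.monotone⟩, fun x => by simpa using hm x⟩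
  have hsurj : Surjective G := (continuous_iff_surjective G).1 hF.1
  obtain ⟨U, hU⟩ := (isUnit_iff_bijective (f := G)).2 ⟨hmono.injective, hsurj⟩
  exact ⟨U, by rw [hU]; rfl⟩

section Smooth

variable {Γ : Subgroup (UnitAddCircle ≃ₜ UnitAddCircle)}

theorem exists_mem_liftGroup (hΓ : ∀ f ∈ Γ, IsDiffOneLip f)
    {f : UnitAddCircle ≃ₜ UnitAddCircle} (hf : f ∈ Γ) :
    ∃ F ∈ liftGroup Γ, ∀ x : ℝ, (F x : UnitAddCircle) = f x := by
  obtain ⟨F, hF, -, hpos, -⟩ := hΓ f hf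
  obtain ⟨G, rfl⟩ := hF.exists_units (strictMono_of_deriv_pos hpos)
  exact ⟨G, ⟨f, hf, hF.2⟩, hF.2⟩

theorem regularity_of_mem_liftGroup (hΓ : ∀ f ∈ Γ, IsDiffOneLip f)
    {F : CircleDeg1Liftˣ} (hF : F ∈ liftGroup Γ) :
    ContDiff ℝ 1 F ∧ (∃ m > 0, ∀ x, m ≤ deriv F x) ∧ ∃ K : NNReal, LipschitzWith K (deriv F) := by
  obtain ⟨f, hf, hFf⟩ := hF
  obtain ⟨G, hG, hC1, hpos, hK⟩ := hΓ f hf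
  obtain ⟨n, hn⟩ := sub_eq_of_continuous_of_coe_eq (units_continuous F) hG.1 fun x => by
    rw [hFf, hG.2]
  have hFG : ⇑F = fun x => G x + n := funext hn
  have hd : deriv F = deriv G := by rw [hFG]; ext x; simp
  have hC1F : ContDiff ℝ 1 F := by rw [hFG]; exact hC1.add contDiff_const
  refine ⟨hC1F, ?_, by rwa [hd]⟩
  have hper : Periodic (deriv F) 1 := fun x => by
    rw [← deriv_comp_add_const]
    simp only [map_add_one, deriv_add_const]
  obtain ⟨y, -, hy⟩ := isCompact_Icc.exists_isMinOn (nonempty_Icc.2 (zero_le_one' ℝ))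
    (hC1F.continuous_deriv le_rfl).continuousOn
  refine ⟨deriv F y, by rw [hd]; exact hpos y, fun x => ?_⟩
  obtain ⟨z, hz, hxz⟩ := hper.exists_mem_Ico₀ one_pos x
  rw [hxz]
  exact hy (Ico_subset_Icc_self hz)

end Smooth

/-! ### Minimal sets -/

theorem exists_minimal_invariant (Γ : Subgroup (UnitAddCircle ≃ₜ UnitAddCircle)) :
    ∃ K : Set UnitAddCircle, Minimal
      (fun K => IsClosed K ∧ K.Nonempty ∧ ∀ f ∈ Γ, ∀ x ∈ K, f x ∈ K) K := by
  refine zorn_superset _ fun c hc hchain => ?_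
  rcases c.eq_empty_or_nonempty with rfl | hne
  · exact ⟨univ, ⟨isClosed_univ, univ_nonempty, fun _ _ _ _ => trivial⟩, by simp⟩
  · have : Nonempty c := hne.to_subtype
    refine ⟨⋂₀ c, ⟨isClosed_sInter fun s hs => (hc hs).1, ?_, fun f hf x hx s hs =>
      (hc hs).2.2 f hf x (hx s hs)⟩, fun s hs => sInter_subset_of_mem hs⟩
    exact IsCompact.nonempty_sInter_of_directed_nonempty_isCompact_isClosed
      (fun s hs t ht => (hchain.total hs ht).elim (fun h => ⟨s, hs, subset_rfl, h⟩)
        fun h => ⟨t, ht, h, subset_rfl⟩) (fun s hs => (hc hs).2.1)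
      (fun s hs => (hc hs).1.isCompact) (fun s hs => (hc hs).1)

/-- The full preimage in `ℝ` of a minimal closed invariant set of the circle. -/
theorem exists_minimal_liftGroup {Γ : Subgroup (UnitAddCircle ≃ₜ UnitAddCircle)}
    (hΓ : ∀ f ∈ Γ, IsDiffOneLip f) :
    ∃ K : Set ℝ, IsClosed K ∧ K.Nonempty ∧ (∀ F ∈ liftGroup Γ, ∀ x ∈ K, F x ∈ K) ∧
      ∀ O : Set ℝ, IsOpen O → (O ∩ K).Nonempty → ∀ x ∈ K, ∃ F ∈ liftGroup Γ, F x ∈ O := by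
  obtain ⟨K, ⟨hcl, ⟨p, hp⟩, hinv⟩, hmin⟩ := exists_minimal_invariant Γ
  have hcoe : Continuous ((↑) : ℝ → UnitAddCircle) := AddCircle.continuous_mk' 1
  refine ⟨(↑) ⁻¹' K, hcl.preimage hcoe, ?_, ?_, ?_⟩
  · obtain ⟨x, rfl⟩ := QuotientAddGroup.mk_surjective p
    exact ⟨x, hp⟩
  · rintro F ⟨f, hf, hF⟩ x hx
    rw [mem_preimage, hF]
    exact hinv f hf _ hx
  · rintro O hO ⟨o, hoO, hoK⟩ x hx
    let Z : Set UnitAddCircle := closure {y | ∃ f ∈ Γ, y = f x}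
    have hZK : Z ⊆ K := closure_minimal (by rintro _ ⟨f, hf, rfl⟩; exact hinv f hf _ hx) hcl
    have hKZ : K ⊆ Z := hmin ⟨isClosed_closure, ⟨_, subset_closure ⟨1, Γ.one_mem, rfl⟩⟩,
      fun f hf y hy => map_mem_closure f.continuous hy (by
        rintro _ ⟨g, hg, rfl⟩; exact ⟨f * g, Γ.mul_mem hf hg, rfl⟩)⟩ hZK
    have hopen : IsOpen (((↑) : ℝ → UnitAddCircle) '' O) := QuotientAddGroup.isOpenMap_coe O hO
    obtain ⟨_, ⟨z, hz, hzf⟩, f, hf, rfl⟩ := mem_closure_iff.1 (hKZ hoK) _ hopen ⟨o, hoO, rfl⟩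
    obtain ⟨F, hF, hFf⟩ := exists_mem_liftGroup hΓ hf
    obtain ⟨m, hm⟩ := UnitAddCircle.coe_eq_coe_iff.1 (hzf.trans (hFf x).symm)
    refine ⟨_, (liftGroup Γ).mul_mem (translate_int_mem_liftGroup Γ m) hF, ?_⟩
    rwa [units_mul_apply, translate_apply, add_comm, ← hm]

/-! ### Invariant measures when elements with fixed points act trivially -/

section Translation

variable {S : Subgroup CircleDeg1Liftˣ} {K : Set ℝ}

/-- If the order were reversed at a point of `K`, then `G⁻¹ * F` would have a fixed point by the
intermediate value theorem while moving that point of `K`. -/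
theorem le_on_of_le_at (hfix : ∀ F ∈ S, (∃ x, F x = x) → ∀ k ∈ K, F k = k)
    {F G : CircleDeg1Liftˣ} (hF : F ∈ S) (hG : G ∈ S) {x : ℝ} (hx : F x ≤ G x) :
    ∀ k ∈ K, F k ≤ G k := by
  intro k hk
  by_contra! hlt
  have hH := S.mul_mem (S.inv_mem hG) hF
  set H := G⁻¹ * F with hHdef
  have hF_eq : ∀ y, F y = G (H y) := fun y => by
    rw [hHdef, units_mul_apply, units_apply_inv_apply]
  have h1 : H x ≤ x := (units_strictMono G).le_iff_le.1 (by rwa [← hF_eq])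
  have h2 : k < H k := (units_strictMono G).lt_iff_lt.1 (by rwa [← hF_eq])
  obtain ⟨y, hy⟩ := mem_range_of_exists_le_of_exists_ge
    (f := fun y => H y - y) (c := 0) ((units_continuous H).sub continuous_id)
    ⟨x, by linarith⟩ ⟨k, by linarith⟩
  exact h2.ne' (hfix H hH ⟨y, sub_eq_zero.1 hy⟩ k hk)

theorem translationNumber_le_of_le_on (hK : K.Nonempty) (hinv : ∀ F ∈ S, ∀ x ∈ K, F x ∈ K)
    {F G : CircleDeg1Liftˣ} (hF : F ∈ S) (h : ∀ k ∈ K, F k ≤ G k) :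
    translationNumber F ≤ translationNumber G := by
  obtain ⟨k, hk⟩ := hK
  refine le_of_tendsto_of_tendsto' (tendsto_translationNumber F k)
    (tendsto_translationNumber G k) fun n => ?_
  gcongr
  rw [coe_pow, coe_pow]
  have : ∀ n : ℕ, F^[n] k ∈ K ∧ F^[n] k ≤ G^[n] k := by
    intro n
    induction n with
    | zero => exact ⟨hk, le_rfl⟩
    | succ n ih =>
      rw [iterate_succ_apply', iterate_succ_apply']
      exact ⟨hinv F hF _ ih.1, (h _ ih.1).trans ((units_strictMono G).monotone ih.2)⟩
  exact (this n).2

theorem dist_translationNumber_mul_le (f g : CircleDeg1Lift) :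
    |translationNumber (f * g) - (translationNumber f + translationNumber g)| ≤ 4 := by
  have h1 := f.dist_map_zero_translationNumber_le
  have h2 := g.dist_map_zero_translationNumber_le
  have h3 := (f * g).dist_map_zero_translationNumber_le
  have h4 := (f.dist_map_map_zero_lt g).le
  rw [mul_apply] at h3
  rw [Real.dist_eq, abs_le] at h1 h2 h3 h4
  rw [abs_le]
  constructor <;> linarith

/-- On `K` the hypothesis sorts words: `F^n G^n ≤ (F G)^n ≤ G^n F^n`. The translation number is
additive up to an error of 4, so `n` times the defect is at most 4 for every `n`. -/
theorem translationNumber_mul_of_le (hK : K.Nonempty) (hinv : ∀ F ∈ S, ∀ x ∈ K, F x ∈ K)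
    {F G : CircleDeg1Liftˣ} (hF : F ∈ S) (hG : G ∈ S)
    (h : ∀ k ∈ K, F (G k) ≤ G (F k)) :
    translationNumber ((F * G : CircleDeg1Liftˣ) : CircleDeg1Lift) =
      translationNumber F + translationNumber G := by
  have hmF := fun n => (units_strictMono F).monotone.iterate n
  have hmG := fun n => (units_strictMono G).monotone.iterate n
  have hFn : ∀ n : ℕ, ∀ k ∈ K, F^[n] k ∈ K := fun n k hk => by
    rw [← units_coe_pow]; exact hinv _ (S.pow_mem hF n) k hk
  have hGn : ∀ n : ℕ, ∀ k ∈ K, G^[n] k ∈ K := fun n k hk => by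
    rw [← units_coe_pow]; exact hinv _ (S.pow_mem hG n) k hk
  have hFG : ∀ n : ℕ, ∀ k ∈ K, F (G^[n] k) ≤ G^[n] (F k) := by
    intro n
    induction n with
    | zero => intro k _; exact le_rfl
    | succ n ih =>
      intro k hk
      rw [iterate_succ_apply', iterate_succ_apply']
      exact (h _ (hGn n k hk)).trans ((units_strictMono G).monotone (ih k hk))
  have hGF : ∀ n : ℕ, ∀ k ∈ K, F^[n] (G k) ≤ G (F^[n] k) := by
    intro n
    induction n with
    | zero => intro k _; exact le_rfl
    | succ n ih =>
      intro k hk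
      rw [iterate_succ_apply', iterate_succ_apply']
      exact ((units_strictMono F).monotone (ih k hk)).trans (h _ (hFn n k hk))
  have lower : ∀ n : ℕ, ∀ k ∈ K, F^[n] (G^[n] k) ≤ (F ∘ G)^[n] k := by
    intro n
    induction n with
    | zero => intro k _; exact le_rfl
    | succ n ih =>
      intro k hk
      calc F^[n + 1] (G^[n + 1] k) = F^[n] (F (G^[n] (G k))) := rfl
        _ ≤ F^[n] (G^[n] (F (G k))) := hmF n (hFG n _ (hinv G hG k hk))
        _ ≤ _ := ih _ (hinv F hF _ (hinv G hG k hk))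
  have upper : ∀ n : ℕ, ∀ k ∈ K, (F ∘ G)^[n] k ≤ G^[n] (F^[n] k) := by
    intro n
    induction n with
    | zero => intro k _; exact le_rfl
    | succ n ih =>
      intro k hk
      calc (F ∘ G)^[n + 1] k ≤ G^[n] (F^[n] (F (G k))) :=
            ih _ (hinv F hF _ (hinv G hG k hk))
        _ ≤ G^[n] (G (F^[n] (F k))) := hmG n (hGF (n + 1) k hk)
        _ = _ := rfl
  have key : ∀ n : ℕ, n * |translationNumber ((F * G : CircleDeg1Liftˣ) : CircleDeg1Lift) -
      (translationNumber F + translationNumber G)| ≤ 4 := by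
    intro n
    have h1 := translationNumber_le_of_le_on (S := S) hK hinv
      (F := F ^ n * G ^ n) (G := (F * G) ^ n) (S.mul_mem (S.pow_mem hF n) (S.pow_mem hG n))
      fun k hk => by
        rw [units_mul_apply, units_coe_pow, units_coe_pow, units_coe_pow]; exact lower n k hk
    have h2 := translationNumber_le_of_le_on (S := S) hK hinv
      (F := (F * G) ^ n) (G := G ^ n * F ^ n) (S.pow_mem (S.mul_mem hF hG) n)
      fun k hk => by
        rw [units_mul_apply, units_coe_pow, units_coe_pow, units_coe_pow]; exact upper n k hk
    have h3 := dist_translationNumber_mul_le ((F : CircleDeg1Lift) ^ n) ((G : CircleDeg1Lift) ^ n)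
    have h4 := dist_translationNumber_mul_le ((G : CircleDeg1Lift) ^ n) ((F : CircleDeg1Lift) ^ n)
    rw [Units.val_mul, Units.val_pow_eq_pow_val, Units.val_pow_eq_pow_val,
      Units.val_pow_eq_pow_val, translationNumber_pow] at h1 h2
    rw [translationNumber_pow, translationNumber_pow, abs_le] at h3 h4
    rw [← Nat.abs_cast n, ← abs_mul, abs_le, mul_sub, mul_add]
    constructor <;> linarith
  by_contra hne
  have hpos := abs_pos.2 (sub_ne_zero.2 hne)
  obtain ⟨n, hn⟩ := exists_nat_gt (4 / |translationNumber ((F * G : CircleDeg1Liftˣ) :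
    CircleDeg1Lift) - (translationNumber F + translationNumber G)|)
  rw [div_lt_iff₀ hpos] at hn
  exact (key n).not_gt hn

/-- If every element of `S` with a fixed point acts trivially on the nonempty invariant set `K`,
then the translation number is a homomorphism on `S`. -/
theorem translationNumber_mul_of_fixed (hK : K.Nonempty) (hinv : ∀ F ∈ S, ∀ x ∈ K, F x ∈ K)
    (hfix : ∀ F ∈ S, (∃ x, F x = x) → ∀ k ∈ K, F k = k)
    {F G : CircleDeg1Liftˣ} (hF : F ∈ S) (hG : G ∈ S) :
    translationNumber ((F * G : CircleDeg1Liftˣ) : CircleDeg1Lift) =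
      translationNumber F + translationNumber G := by
  obtain ⟨k, -⟩ := id hK
  -- Conjugation invariance makes the roles of `F` and `G` symmetric, so either order of `F (G k)`
  -- and `G (F k)` will do.
  have hconj : translationNumber ((F * G : CircleDeg1Liftˣ) : CircleDeg1Lift) =
      translationNumber ((G * F : CircleDeg1Liftˣ) : CircleDeg1Lift) := by
    have := translationNumber_conj_eq F ((G * F : CircleDeg1Liftˣ) : CircleDeg1Lift)
    rw [← this, ← Units.val_mul, ← Units.val_mul]
    congr 2
    group
  rcases le_total (F (G k)) (G (F k)) with h | h
  · exact translationNumber_mul_of_le hK hinv hF hG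
      (le_on_of_le_at hfix (S.mul_mem hF hG) (S.mul_mem hG hF) h)
  · rw [hconj, add_comm]
    exact translationNumber_mul_of_le hK hinv hG hF
      (le_on_of_le_at hfix (S.mul_mem hG hF) (S.mul_mem hF hG) h)

/-- A monotone map semiconjugating translations to the action of `S`. -/
theorem exists_monotone_semiconj (hK : K.Nonempty) (hinv : ∀ F ∈ S, ∀ x ∈ K, F x ∈ K)
    (hfix : ∀ F ∈ S, (∃ x, F x = x) → ∀ k ∈ K, F k = k)
    (htrans : ∀ m : ℤ, translate (Multiplicative.ofAdd (m : ℝ)) ∈ S) :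
    ∃ ψ : ℝ → ℝ, Monotone ψ ∧ ∀ H ∈ S, ∀ t, ψ (t + translationNumber H) = H (ψ t) := by
  obtain ⟨x, -⟩ := id hK
  have hne : ∀ t : ℝ, {y | ∃ G ∈ S, translationNumber G ≤ t ∧ y = G x}.Nonempty := fun t =>
    ⟨_, _, htrans ⌊t⌋, by rw [translationNumber_translate]; exact Int.floor_le t, rfl⟩
  have hbdd : ∀ t : ℝ, BddAbove {y | ∃ G ∈ S, translationNumber G ≤ t ∧ y = G x} := by
    refine fun t => ⟨x + t + 1, ?_⟩
    rintro _ ⟨G, -, hG, rfl⟩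
    have := map_lt_add_translationNumber_add_one G x
    linarith
  -- Left multiplication by `H` carries the set indexed by `t` onto the one indexed by `t +
  -- translationNumber H`, and `H` commutes with suprema.
  refine ⟨fun t => sSup {y | ∃ G ∈ S, translationNumber G ≤ t ∧ y = G x}, fun s t hst => ?_,
    fun H hH t => ?_⟩
  · exact csSup_le_csSup (hbdd t) (hne s) fun y ⟨G, hG, hGs, hy⟩ => ⟨G, hG, hGs.trans hst, hy⟩
  · have himage : {y | ∃ G ∈ S, translationNumber G ≤ t + translationNumber H ∧ y = G x} =
        toOrderIso H '' {y | ∃ G ∈ S, translationNumber G ≤ t ∧ y = G x} := by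
      ext y
      constructor
      · rintro ⟨G, hG, hGt, rfl⟩
        refine ⟨_, ⟨H⁻¹ * G, S.mul_mem (S.inv_mem hH) hG, ?_, rfl⟩,
          units_apply_inv_apply H _⟩
        rw [translationNumber_mul_of_fixed hK hinv hfix (S.inv_mem hH) hG,
          translationNumber_units_inv]
        linarith
      · rintro ⟨_, ⟨G, hG, hGt, rfl⟩, rfl⟩
        refine ⟨H * G, S.mul_mem hH hG, ?_, rfl⟩
        rw [translationNumber_mul_of_fixed hK hinv hfix hH hG]
        linarith
    change sSup _ = toOrderIso H (sSup _)
    rw [himage, sSup_image', (toOrderIso H).map_csSup (hne t) (hbdd t)]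

end Translation

/-- The semiconjugacy `ψ` commutes with integer translations, so it descends to a circle map
intertwining rotations with the elements of `Γ`; it pushes Lebesgue measure to an invariant one. -/
theorem exists_invariant_measure {Γ : Subgroup (UnitAddCircle ≃ₜ UnitAddCircle)}
    (hΓ : ∀ f ∈ Γ, IsDiffOneLip f) {K : Set ℝ} (hK : K.Nonempty)
    (hinv : ∀ F ∈ liftGroup Γ, ∀ x ∈ K, F x ∈ K)
    (hfix : ∀ F ∈ liftGroup Γ, (∃ x, F x = x) → ∀ k ∈ K, F k = k) :
    ∃ μ : Measure UnitAddCircle, IsProbabilityMeasure μ ∧ IsInvariantUnder Γ μ := by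
  obtain ⟨ψ, hψ, hsemi⟩ := exists_monotone_semiconj hK hinv hfix (translate_int_mem_liftGroup Γ)
  have hψ_int : ∀ (m : ℤ) t, ψ (t + m) = ψ t + m := fun m t => by
    have := hsemi _ (translate_int_mem_liftGroup Γ m) t
    rwa [translationNumber_translate, translate_apply, add_comm (m : ℝ)] at this
  let φ : UnitAddCircle → UnitAddCircle := fun θ => ((ψ (AddCircle.equivIoc 1 0 θ) : ℝ))
  have hφ : ∀ t : ℝ, φ t = (ψ t : ℝ) := fun t => by
    obtain ⟨m, hm⟩ := UnitAddCircle.coe_eq_coe_iff.1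
      (show (((AddCircle.equivIoc 1 0 (t : UnitAddCircle) : ℝ)) : UnitAddCircle) = t from
        (AddCircle.equivIoc 1 0).symm_apply_apply _)
    refine UnitAddCircle.coe_eq_coe_iff.2 ⟨m, ?_⟩
    rw [hm, hψ_int]
  have hφm : Measurable φ := by
    have h1 : Measurable fun θ : UnitAddCircle => ((AddCircle.equivIoc 1 0 θ : ℝ)) :=
      measurable_subtype_coe.comp (AddCircle.measurableEquivIoc 1 0).measurable
    exact (AddCircle.continuous_mk' 1).measurable.comp (hψ.measurable.comp h1)
  have : IsProbabilityMeasure (volume : Measure UnitAddCircle) := ⟨UnitAddCircle.measure_univ⟩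
  refine ⟨Measure.map φ volume, Measure.isProbabilityMeasure_map hφm.aemeasurable,
    fun f hf => ⟨f.continuous.measurable, ?_⟩⟩
  obtain ⟨F, hF, hFf⟩ := exists_mem_liftGroup hΓ hf
  have hcomp : f ∘ φ = φ ∘ fun θ => θ + ((translationNumber F : ℝ) : UnitAddCircle) := by
    ext θ
    obtain ⟨t, rfl⟩ := QuotientAddGroup.mk_surjective θ
    change f (φ (t : UnitAddCircle)) = φ ((t : UnitAddCircle) + _)
    rw [← AddCircle.coe_add, hφ, hφ, hsemi F hF, hFf]
  rw [Measure.map_map f.continuous.measurable hφm, hcomp,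
    ← Measure.map_map hφm (measurable_add_const _), map_add_right_eq_self]

/-! ### Crossing intervals -/

/-- Extremal argument: let `t` be the supremum of `G b` over those `G` with `G a < k < G b`. It lies
in `K`, so some `H` sends it into `(a, b)`. Take such a `G` with `G b` close to `t`. Either `H * G`
crosses, or `H⁻¹` is itself admissible with `H⁻¹ b > t`. -/
theorem exists_crossing {S : Subgroup CircleDeg1Liftˣ} {K : Set ℝ} (hcl : IsClosed K)
    (hinv : ∀ F ∈ S, ∀ x ∈ K, F x ∈ K)
    (hmin : ∀ O : Set ℝ, IsOpen O → (O ∩ K).Nonempty → ∀ x ∈ K, ∃ F ∈ S, F x ∈ O)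
    {a b k : ℝ} (hk : k ∈ K) (hb : b ∈ K) (hkab : k ∈ Ioo a b) (hab : b ≤ a + 1) :
    ∃ F ∈ S, F a < a ∧ a < F b ∧ F b < b := by
  by_contra! hno
  let T : Set ℝ := {y | ∃ G ∈ S, G a < k ∧ k < G b ∧ y = G b}
  have hTne : T.Nonempty := ⟨b, 1, S.one_mem, hkab.1, hkab.2, rfl⟩
  have hTb : BddAbove T := by
    refine ⟨k + 1, ?_⟩
    rintro _ ⟨G, -, h1, -, rfl⟩
    have := (units_strictMono G).monotone hab
    rw [map_add_one] at this
    linarith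
  have ht : sSup T ∈ K := by
    refine closure_minimal ?_ hcl (csSup_mem_closure hTne hTb)
    rintro _ ⟨G, hG, -, -, rfl⟩
    exact hinv G hG b hb
  obtain ⟨H, hH, hHt⟩ := hmin (Ioo a b) isOpen_Ioo ⟨k, hkab, hk⟩ _ ht
  have h1 : H⁻¹ a < sSup T := by
    rw [← (units_strictMono H).lt_iff_lt, units_apply_inv_apply]; exact hHt.1
  have h2 : sSup T < H⁻¹ b := by
    rw [← (units_strictMono H).lt_iff_lt, units_apply_inv_apply]; exact hHt.2
  obtain ⟨_, ⟨G, hG, hGa, hGb, rfl⟩, hlt⟩ := exists_lt_of_lt_csSup hTne h1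
  have hGt : G b ≤ sSup T := le_csSup hTb ⟨G, hG, hGa, hGb, rfl⟩
  rcases lt_or_ge (G a) (H⁻¹ a) with h | h
  · refine (hno (H * G) (S.mul_mem hH hG) ?_ ?_).not_gt ?_ <;> rw [units_mul_apply]
    · simpa only [units_apply_inv_apply] using units_strictMono H h
    · simpa only [units_apply_inv_apply] using units_strictMono H hlt
    · simpa only [units_apply_inv_apply] using units_strictMono H (hGt.trans_lt h2)
  · exact h2.not_ge (le_csSup hTb ⟨H⁻¹, S.inv_mem hH, h.trans_lt hGa,
      hGb.trans (hGt.trans_lt h2), rfl⟩)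

/-- The component, in the complement of the fixed point set, of a point moved to the right. -/
theorem exists_component {G : CircleDeg1Liftˣ} {p k : ℝ} (hp : G p = p) (hk : k < G k) :
    ∃ a b, k ∈ Ioo a b ∧ b ≤ a + 1 ∧ G a = a ∧ G b = b ∧ ∀ x ∈ Ioo a b, x < G x := by
  have hcl : IsClosed {x | G x = x} := isClosed_eq (units_continuous G) continuous_id
  have hint : ∀ m : ℤ, G (p + m) = p + m := fun m => by rw [map_add_int, hp]
  let A : Set ℝ := {x | G x = x} ∩ Iic k
  let B : Set ℝ := {x | G x = x} ∩ Ici k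
  have hA : A.Nonempty := ⟨p + ⌊k - p⌋, hint _, by
    have := Int.floor_le (k - p); simp only [mem_Iic]; linarith⟩
  have hB : B.Nonempty := ⟨p + ⌈k - p⌉, hint _, by
    have := Int.le_ceil (k - p); simp only [mem_Ici]; linarith⟩
  have hAb : BddAbove A := ⟨k, fun _ h => h.2⟩
  have hBb : BddBelow B := ⟨k, fun _ h => h.2⟩
  obtain ⟨ha, hak⟩ := (hcl.inter isClosed_Iic).csSup_mem hA hAb
  obtain ⟨hb, hbk⟩ := (hcl.inter isClosed_Ici).csInf_mem hB hBb
  change G (sSup A) = sSup A at ha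
  change G (sInf B) = sInf B at hb
  change sSup A ≤ k at hak
  change k ≤ sInf B at hbk
  have hak' : sSup A < k := hak.lt_of_ne fun h => by rw [h] at ha; exact hk.ne' ha
  have hbk' : k < sInf B := hbk.lt_of_ne fun h => by rw [← h] at hb; exact hk.ne' hb
  refine ⟨sSup A, sInf B, ⟨hak', hbk'⟩, ?_, ha, hb, fun x hx => ?_⟩
  · have h1 : G (sSup A + 1) = sSup A + 1 := by rw [map_add_one, ha]
    refine csInf_le hBb ⟨h1, ?_⟩
    by_contra h
    rw [mem_Ici] at h
    have := le_csSup hAb ⟨h1, (lt_of_not_ge h).le⟩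
    linarith
  · by_contra! hle
    obtain ⟨y, hy, hy0⟩ := isPreconnected_uIcc.intermediate_value (left_mem_uIcc (a := x) (b := k))
      right_mem_uIcc ((units_continuous G).sub continuous_id).continuousOn
      (show (0 : ℝ) ∈ Icc (G x - x) (G k - k) from ⟨by linarith, by linarith⟩)
    have hy1 : G y = y := sub_eq_zero.1 hy0
    have hyab : y ∈ Ioo (sSup A) (sInf B) := ordConnected_Ioo.uIcc_subset hx ⟨hak', hbk'⟩ hy
    rcases le_total y k with h | h
    · exact (le_csSup hAb ⟨hy1, h⟩).not_gt hyab.1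
    · exact (csInf_le hBb ⟨hy1, h⟩).not_gt hyab.2

theorem mul_deriv_eq_one_of_inverse {P Q : ℝ → ℝ} {z d e : ℝ} (hPQ : ∀ y, P (Q y) = y)
    (hz : Q z = z) (hP : HasDerivAt P d z) (hQ : HasDerivAt Q e z) : d * e = 1 := by
  rw [← hz] at hP
  have h := hP.comp z hQ
  have hid : P ∘ Q = id := funext hPQ
  rw [hid] at h
  exact h.unique (hasDerivAt_id z)

/-- If `F` crosses the interval `(a, b)`, and `G` moves its points from the fixed point `a` towards
the fixed point `b`, then some `F * G ^ n` has a contracting and an expanding fixed point. -/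
theorem exists_hyperbolic_of_crossing {Γ : Subgroup (UnitAddCircle ≃ₜ UnitAddCircle)}
    (hΓ : ∀ f ∈ Γ, IsDiffOneLip f) {F G : CircleDeg1Liftˣ} (hF : F ∈ liftGroup Γ)
    (hG : G ∈ liftGroup Γ) {a b : ℝ} (ha : G a = a) (hb : G b = b)
    (hlt : ∀ x ∈ Ioo a b, x < G x) (h1 : F a < a) (h2 : a < F b) (h3 : F b < b) :
    ∃ H ∈ liftGroup Γ, ∃ x w d e, H x = x ∧ H w = w ∧ HasDerivAt H d x ∧ HasDerivAt H e w ∧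
      0 < d ∧ d < 1 ∧ 1 < e := by
  obtain ⟨hFC, ⟨mF, hmF, hmF'⟩, -⟩ := regularity_of_mem_liftGroup hΓ hF
  obtain ⟨hGC, ⟨mG, hmG, hmG'⟩, KG, hKG⟩ := regularity_of_mem_liftGroup hΓ hG
  obtain ⟨hFiC, ⟨mFi, hmFi, hmFi'⟩, -⟩ :=
    regularity_of_mem_liftGroup hΓ ((liftGroup Γ).inv_mem hF)
  obtain ⟨hGiC, ⟨mGi, hmGi, hmGi'⟩, KGi, hKGi⟩ :=
    regularity_of_mem_liftGroup hΓ ((liftGroup Γ).inv_mem hG)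
  have hFd := hFC.differentiable (by norm_num)
  have hGd := hGC.differentiable (by norm_num)
  have hGid := hGiC.differentiable (by norm_num)
  have hai : G⁻¹ a = a := by
    conv_lhs => rw [← ha]
    exact units_inv_apply_apply G a
  have hlti : ∀ x ∈ Ioo a b, G⁻¹ x < x := fun x hx => by
    rw [← (units_strictMono G).lt_iff_lt, units_apply_inv_apply]
    exact hlt x hx
  have hFia : F⁻¹ a ∈ Ioo a b := by
    constructor <;> rw [← (units_strictMono F).lt_iff_lt, units_apply_inv_apply] <;> assumption
  have ev1 := eventually_contracting_of_attracting_right hFC (fun x => hmF.trans_le (hmF' x))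
    hGd hKG hmG hmG' hb hlt ⟨h2, h3⟩
  have ev2 := eventually_contracting_of_attracting_left hFiC (fun x => hmFi.trans_le (hmFi' x))
    hGid hKGi hmGi hmGi' hai hlti hFia
  obtain ⟨n, ⟨x, hx, d, hd, hd0, hd1⟩, z, hz, d', hd', hd'0, hd'1⟩ := (ev1.and ev2).exists
  have hcoe : ⇑(F * G ^ n : CircleDeg1Liftˣ) = fun y => F (G^[n] y) := by
    ext y; rw [units_mul_apply, units_coe_pow]
  have hGinv : ∀ y, (G⁻¹ : CircleDeg1Liftˣ)^[n] (G^[n] y) = y :=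
    LeftInverse.iterate (fun y => units_inv_apply_apply G y) n
  have hGinv' : ∀ y, G^[n] ((G⁻¹ : CircleDeg1Liftˣ)^[n] y) = y :=
    LeftInverse.iterate (fun y => units_apply_inv_apply G y) n
  have hFz : F z = (G⁻¹ : CircleDeg1Liftˣ)^[n] z := by
    conv_lhs => rw [← hz]
    exact units_apply_inv_apply F _
  have hGFz : G^[n] (F z) = z := by rw [hFz, hGinv']
  have hD := hasDerivAt_iterate_prod hGd n (F z)
  have hQ := hD.comp z (hFd z).hasDerivAt
  have hH : HasDerivAt (fun y => F (G^[n] y)) _ (F z) :=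
    (hFd (G^[n] (F z))).hasDerivAt.comp (F z) hD
  rw [← hcoe] at hd hH
  -- The point `F z` is fixed by `F ∘ G^n` with the same multiplier as `z` under `G^n ∘ F`, and the
  -- latter is inverse to `F⁻¹ ∘ G⁻ⁿ`.
  have hmul := mul_deriv_eq_one_of_inverse
    (fun y => by simp only [comp, hGinv, units_inv_apply_apply]) hGFz hd' hQ
  refine ⟨F * G ^ n, (liftGroup Γ).mul_mem hF ((liftGroup Γ).pow_mem hG n), x, F z, d, _,
    by simp only [hcoe, hx], by simp only [hcoe, hGFz], hd, hH, hd0, hd1, ?_⟩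
  rw [hGFz, mul_comm]
  by_contra! hle
  have := mul_le_mul_of_nonneg_left hle hd'0.le
  linarith

theorem mainTheorem7 (Γ : Subgroup (UnitAddCircle ≃ₜ UnitAddCircle))
    (hΓ : ∀ f ∈ Γ, IsDiffOneLip f)
    (hinv : ¬ ∃ μ : Measure UnitAddCircle, IsProbabilityMeasure μ ∧ IsInvariantUnder Γ μ) :
    ∃ f ∈ Γ, ∃ p q : UnitAddCircle, p ≠ q ∧
      IsContractingFixedPt f p ∧ IsExpandingFixedPt f q := by
  obtain ⟨K, hcl, hne, hKinv, hmin⟩ := exists_minimal_liftGroup hΓ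
  obtain ⟨G, hG, ⟨p, hp⟩, k, hk, hGk⟩ :
      ∃ G ∈ liftGroup Γ, (∃ x, G x = x) ∧ ∃ k ∈ K, k < G k := by
    by_contra! hno
    -- Applying the negated claim to `F⁻¹` as well excludes motion to the left.
    refine hinv (exists_invariant_measure hΓ hne hKinv fun F hF ⟨x, hx⟩ k hk =>
      le_antisymm (hno F hF ⟨x, hx⟩ k hk) ?_)
    have hFi : F⁻¹ x = x := by
      conv_lhs => rw [← hx]
      exact units_inv_apply_apply F x
    have := (units_strictMono F).monotone
      (hno F⁻¹ ((liftGroup Γ).inv_mem hF) ⟨x, hFi⟩ k hk)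
    rwa [units_apply_inv_apply] at this
  obtain ⟨a, b, hkab, hab, ha, hb, hlt⟩ := exists_component hp hGk
  have hbK : b ∈ K := by
    refine hcl.mem_of_tendsto (tendsto_iterate_right (units_continuous G) (units_strictMono G)
      hb hlt hkab) (Eventually.of_forall fun n => ?_)
    rw [← units_coe_pow]
    exact hKinv _ ((liftGroup Γ).pow_mem hG n) k hk
  obtain ⟨F, hF, h1, h2, h3⟩ := exists_crossing hcl hKinv hmin hk hbK hkab hab
  obtain ⟨H, ⟨f, hf, hHf⟩, x, w, d, e, hx, hw, hd, he, hd0, hd1, he1⟩ :=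
    exists_hyperbolic_of_crossing hΓ hF hG ha hb hlt h1 h2 h3
  have hlift : IsCircleLift H f := ⟨units_continuous H, hHf⟩
  refine ⟨f, hf, x, w, fun hxw => ?_,
    ⟨by rw [IsFixedPt, ← hHf, hx], d, ⟨H, hlift, x, rfl, hd⟩, hd0, hd1⟩,
    ⟨by rw [IsFixedPt, ← hHf, hw], e, ⟨H, hlift, w, rfl, he⟩, he1⟩⟩
  -- `H` commutes with integer translations, so lifts of the same point have equal derivatives,
  -- against `d < 1 < e`.
  obtain ⟨m, rfl⟩ := UnitAddCircle.coe_eq_coe_iff.1 hxw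
  have hd2 : HasDerivAt (fun y => H (y + m)) d w := hd.comp_add_const w _
  simp only [map_add_int] at hd2
  have hde : d = e := hd2.unique (he.add_const _)
  linarith
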